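/- **Machine.** A machine has an unbounded slow memory and a fast memory of $M$ words; a load (store) copies one word from slow to fast (fast to slow) memory, arithmetic is done only on words in fast memory, and words of fast memory may be discarded or replaced by results at any time. *Sparse Cholesky factorization* of a real symmetric positive definite $N\times N$ matrix $B=LL^T$ means computing $$L_{jj}=\Big(B_{jj}-\sum_{k<j}L_{jk}^2\Big)^{1/2},\qquad L_{ij}=\Big(B_{ij}-\sum_{k<j}L_{ik}L_{jk}\Big)/L_{jj}\quad(i>j)$$ by these formulas: the terms of each sum are evaluated and accumulated in any order and grouping (partial sums may be kept, moved and added up), a product $L_{ik}L_{jk}$ may be omitted only if one of its factors is known to be zero, and each $L_{ij}$ is computed at most once. Initially the lower triangle of $B$ is in slow memory and fast memory is empty; at the end every entry of $L$ not known to be zero is present in fast or slow memory. **Grid.** Let the nodes of the $n\times n$ grid be joined to their horizontal and vertical nearest neighbours. A *five-point matrix* is a real $n^2\times n^2$ matrix $A$ indexed by the nodes, whose off-diagonal entry $A_{pq}$ is negative if $p,q$ are neighbours and $0$ otherwise (for example the discrete Laplacian, with diagonal entries $4$ and entries $-1$ at neighbours). **Theorem.** There is an absolute constant $c>0$ such that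 for all $n,M\ge 1$, every ordering of the $n^2$ grid nodes (diagonal pivot order, with permutation matrix $P$), and $B=PAP^T$, the following hold. 1. If $A$ is a five-point matrix and $B=LL^T$ with $L$ lower triangular with positive diagonal, then every execution of sparse Cholesky factorization of $B$ with fast memory of $M$ words, even if it treats every entry of $L$ that is equal to zero as known to be zero, moves (loads plus stores) at least $c\,n^3/\sqrt M$ words. 2. The same bound holds if $A$ is any real symmetric positive definite matrix with $A_{pq}\neq0$ for all neighbours $p,q$ (and arbitrary other entries), when the entries of $L$ known to be zero are those that are not structurally nonzero. Here the structurally nonzero entries form the smallest set of positions $(i,j)$, $j\le i$, that contains those with $B_{ij}\ne0$, and contains $(i,j)$ whenever it contains $(i,k)$ and $(j,k)$ for some $k<j\le i$. That is, sparse Cholesky factorization of the matrix of a five-point stencil on an $n\times n$ grid needs $\Omega(n^3/\sqrt M)$ words of communication. -/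

import Mathlib

namespace SparseCholesky

/-! ### Matrices of five-point stencils and their Cholesky factors -/

/-- The `n × n` grid graph: a node is joined to its horizontal and vertical nearest neighbours. -/
abbrev grid (n : ℕ) : SimpleGraph (Fin n × Fin n) :=
  SimpleGraph.boxProd (SimpleGraph.pathGraph n) (SimpleGraph.pathGraph n)

/-- `A` represents a five-point stencil on the grid (variable coefficients allowed): an off-diagonal
entry is negative at neighbouring nodes and zero otherwise. The standard example is the discrete
Laplacian, with diagonal entries `4` and the entries `-1` at neighbouring nodes. -/
def IsFivePointMatrix {n : ℕ} (A : Matrix (Fin n × Fin n) (Fin n × Fin n) ℝ) : Prop :=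
  ∀ p q, p ≠ q → ((grid n).Adj p q → A p q < 0) ∧ (¬ (grid n).Adj p q → A p q = 0)

/-- The matrix `P A Pᵀ` in which the node `p` has the position `σ p` (diagonal pivoting). -/
def reorder {n : ℕ} (A : Matrix (Fin n × Fin n) (Fin n × Fin n) ℝ)
    (σ : Fin n × Fin n ≃ Fin (n * n)) : Matrix (Fin (n * n)) (Fin (n * n)) ℝ :=
  A.submatrix σ.symm σ.symm

/-- `L` is the Cholesky factor of `B`. -/
def IsCholeskyFactor {N : ℕ} (B L : Matrix (Fin N) (Fin N) ℝ) : Prop :=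
  (∀ i j, i < j → L i j = 0) ∧ (∀ i, 0 < L i i) ∧ L * L.transpose = B

/-- The structurally nonzero entries `(i, j)`, `j ≤ i`, of the Cholesky factor of `B` (symbolic
factorization, no accidental cancellation): in
`L i j = (B i j - ∑ k < j, L i k * L j k) / L j j`
the entry `B i j` is nonzero or one of the products has two structurally nonzero factors. -/
inductive StructNonzero {N : ℕ} (B : Matrix (Fin N) (Fin N) ℝ) : Fin N → Fin N → Prop
  | input (i j : Fin N) : j ≤ i → B i j ≠ 0 → StructNonzero B i j
  | fill (i j k : Fin N) : k < j → j ≤ i → StructNonzero B i k → StructNonzero B j k →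
      StructNonzero B i j

/-! ### Cholesky factorization on a machine with a fast memory of `M` words -/

/-- What a word of memory may hold.
* `part i j K` is a partial sum of `B i j - ∑ k < j, L i k * L j k`: it contains the term `B i j` if
  `none ∈ K`, and the term `L i k * L j k` if `some k ∈ K`. In particular `part i j {none}` is
  the input entry `B i j`, and `part i j ∅` is an accumulator that holds `0`.
* `entry i j` is the finished entry `L i j`. -/
inductive Word (N : ℕ) : Type
  | part (i j : Fin N) (K : Finset (Option (Fin N)))
  | entry (i j : Fin N)
  deriving DecidableEq

/-- The contents of the fast and of the slow memory, and the set of entries of `L` computed so far.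
Slow memory is unbounded, so nothing in it ever has to be overwritten. -/
structure State (N : ℕ) : Type where
  fast : Finset (Word N)
  slow : Set (Word N)
  computed : Set (Fin N × Fin N)

/-- Initially the matrix (its lower triangle) is in slow memory, and fast memory is empty. -/
def State.initial (N : ℕ) : State N where
  fast := ∅
  slow := {w | ∃ i j : Fin N, j ≤ i ∧ w = Word.part i j {none}}
  computed := ∅

/-- `Step M B Nz s d t`: one instruction leads from the state `s` to the state `t` and moves `d` words
between fast and slow memory. `M` is the size of fast memory, `B` the matrix to be factored,
and `Nz i j` says that `L i j` is not known to be zero: a product `L i k * L j k` may be left out of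
the sum for `L i j` only if one of its factors is known to be zero. Arithmetic is done only on words
in fast memory, a result may replace any word there (such as one of its operands), and each entry
of `L` is computed at most once. -/
inductive Step {N : ℕ} (M : ℕ) (B : Matrix (Fin N) (Fin N) ℝ) (Nz : Fin N → Fin N → Prop) :
    State N → ℕ → State N → Prop
  /-- Copy a word from slow to fast memory. -/
  | load (s : State N) (w : Word N) (F : Finset (Word N)) :
      w ∈ s.slow → F ⊆ insert w s.fast → F.card ≤ M →
      Step M B Nz s 1 { s with fast := F }
  /-- Copy a word from fast to slow memory. -/
  | store (s : State N) (w : Word N) :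
      w ∈ s.fast → Step M B Nz s 1 { s with slow := insert w s.slow }
  /-- Discard words of fast memory. -/
  | discard (s : State N) (F : Finset (Word N)) :
      F ⊆ s.fast → Step M B Nz s 0 { s with fast := F }
  /-- Start an accumulator at zero. -/
  | zero (s : State N) (i j : Fin N) (F : Finset (Word N)) :
      j ≤ i → F ⊆ insert (Word.part i j ∅) s.fast → F.card ≤ M →
      Step M B Nz s 0 { s with fast := F }
  /-- Multiply `L i k` by `L j k`, and accumulate the product. -/
  | multiply (s : State N) (i j k : Fin N) (K : Finset (Option (Fin N))) (F : Finset (Word N)) :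
      k < j → j ≤ i → some k ∉ K →
      Word.entry i k ∈ s.fast → Word.entry j k ∈ s.fast → Word.part i j K ∈ s.fast →
      F ⊆ insert (Word.part i j (insert (some k) K)) s.fast → F.card ≤ M →
      Step M B Nz s 0 { s with fast := F }
  /-- Add two partial sums without common terms. -/
  | add (s : State N) (i j : Fin N) (K K' : Finset (Option (Fin N))) (F : Finset (Word N)) :
      Disjoint K K' → Word.part i j K ∈ s.fast → Word.part i j K' ∈ s.fast →
      F ⊆ insert (Word.part i j (K ∪ K')) s.fast → F.card ≤ M →
      Step M B Nz s 0 { s with fast := F }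
  /-- Finish `L i j`: divide the completed sum by `L j j` if `j < i`, take its root if `j = i`. -/
  | finish (s : State N) (i j : Fin N) (K : Finset (Option (Fin N))) (F : Finset (Word N)) :
      j ≤ i → (i, j) ∉ s.computed → Word.part i j K ∈ s.fast →
      (B i j ≠ 0 → none ∈ K) → (∀ k, k < j → Nz i k → Nz j k → some k ∈ K) →
      (j < i → Word.entry j j ∈ s.fast) →
      F ⊆ insert (Word.entry i j) s.fast → F.card ≤ M →
      Step M B Nz s 0 { s with fast := F, computed := insert (i, j) s.computed }

/-- `Run M B Nz s W t`: a finite sequence of instructions leads from `s` to `t`, and `W` is its total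
number of words moved (loads and stores). -/
inductive Run {N : ℕ} (M : ℕ) (B : Matrix (Fin N) (Fin N) ℝ) (Nz : Fin N → Fin N → Prop) :
    State N → ℕ → State N → Prop
  | nil (s : State N) : Run M B Nz s 0 s
  | snoc (s t u : State N) (W d : ℕ) :
      Run M B Nz s W t → Step M B Nz t d u → Run M B Nz s (W + d) u

/-- Some execution on a machine with a fast memory of `M` words computes the Cholesky factorization
of `B`, with the nonzero structure `Nz` of the factor, by moving exactly `W` words: in the end every
entry `L i j` that is not known to be zero is available in fast or slow memory. -/
def FactorsWith {N : ℕ} (M : ℕ) (B : Matrix (Fin N) (Fin N) ℝ) (Nz : Fin N → Fin N → Prop)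
    (W : ℕ) : Prop :=
  ∃ t : State N, Run M B Nz (State.initial N) W t ∧
    ∀ i j : Fin N, j ≤ i → Nz i j → Word.entry i j ∈ t.fast ∨ Word.entry i j ∈ t.slow

end SparseCholesky

/-!
Eliminating the pivots in order joins two nodes as soon as some path between them has only
eliminated interior nodes. Consider the first line (row or column) of the grid to be completely
eliminated, say a row. Every column except the one of its last node still contains a node that has
not been eliminated. Following each of these columns from the row until it leaves the eliminated
set, one gets `n - 1` nodes that are pairwise joined through the row, hence a dense triangular block
of order `n - 1` of the factor, which requires `(n - 1).choose 3` products `L i k * L j k`. For a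
five-point matrix no entry of this block vanishes by cancellation, since all terms of the
recurrence for the off-diagonal entries of the factor have the same sign.

The communication bound follows by cutting an execution into segments that move `M` words. The
products accumulated in a segment project onto at most `3 * M` positions of the factor, so by the
Loomis–Whitney inequality there are at most `(3 * M) ^ (3 / 2)` of them.
-/

namespace SparseCholesky

/-! ### Fill paths -/

section FillPaths

variable {N : ℕ} {G : SimpleGraph (Fin N)} {B : Matrix (Fin N) (Fin N) ℝ} {t : ℕ} {u v w : Fin N}

/-- `FillPath G t u v`: some path of `G` from `u` to `v` has only interior nodes with positions
less than `t`. Eliminating the positions less than `t` then joins `u` and `v`. -/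
inductive FillPath (G : SimpleGraph (Fin N)) (t : ℕ) (u : Fin N) : Fin N → Prop
  | edge {v : Fin N} : G.Adj u v → FillPath G t u v
  | snoc {w v : Fin N} : FillPath G t u w → (w : ℕ) < t → G.Adj w v → FillPath G t u v

namespace FillPath

theorem trans (huw : FillPath G t u w) (hw : (w : ℕ) < t) (hwv : FillPath G t w v) :
    FillPath G t u v := by
  induction hwv with
  | edge hadj => exact .snoc huw hw hadj
  | snoc _ hx hadj ih => exact .snoc ih hx hadj

theorem symm (h : FillPath G t u v) : FillPath G t v u := by
  induction h with
  | edge hadj => exact .edge hadj.symm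
  | snoc _ hw hadj ih => exact .trans (.edge hadj.symm) hw ih

theorem trans_walk {V : Type*} {H : SimpleGraph V} {a b : V} (φ : H →g G)
    (hφ : ∀ c, (φ c : ℕ) < t) (hu : FillPath G t u (φ a)) (p : H.Walk a b) :
    FillPath G t u (φ b) := by
  induction p with
  | nil => exact hu
  | cons hadj _ ih => exact ih (.snoc hu (hφ _) (φ.map_adj hadj))

theorem exists_of_walk {V : Type*} {H : SimpleGraph V} {a b : V} (φ : H →g G)
    (ha : (φ a : ℕ) < t) (hb : t ≤ φ b) (p : H.Walk a b) :
    ∃ c, t ≤ φ c ∧ FillPath G t (φ a) (φ c) := by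
  induction p with
  | nil => exact absurd ha hb.not_gt
  | @cons a x _ hadj _ ih =>
    have hax : FillPath G t (φ a) (φ x) := .edge (φ.map_adj hadj)
    rcases lt_or_ge (φ x : ℕ) t with hx | hx
    · obtain ⟨c, hc, hxc⟩ := ih hx hb
      exact ⟨c, hc, hax.trans hx hxc⟩
    · exact ⟨x, hx, hax⟩

theorem split_at (h : FillPath G (t + 1) u v) :
    FillPath G t u v ∨ ∃ w : Fin N, (w : ℕ) = t ∧ FillPath G t u w ∧ FillPath G t w v := by
  induction h with
  | edge hadj => exact .inl (.edge hadj)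
  | @snoc x v _ hx hadj ih =>
    rcases Nat.lt_succ_iff_lt_or_eq.1 hx with hlt | heq
    · rcases ih with hux | ⟨w, hw, huw, hwx⟩
      · exact .inl (.snoc hux hlt hadj)
      · exact .inr ⟨w, hw, huw, .snoc hwx hlt hadj⟩
    · rcases ih with hux | ⟨w, hw, huw, -⟩
      · exact .inr ⟨x, heq, hux, .edge hadj⟩
      · obtain rfl : w = x := Fin.ext (hw.trans heq.symm)
        exact .inr ⟨w, hw, huw, .edge hadj⟩

end FillPath

/-- The graph of the strictly lower triangle of `B`: the positions `j < i` are joined if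
`B i j ≠ 0`. The upper triangle is irrelevant, since the machine never reads it. -/
def lowerGraph (B : Matrix (Fin N) (Fin N) ℝ) : SimpleGraph (Fin N) :=
  .fromRel fun i j => j < i ∧ B i j ≠ 0

theorem lowerGraph_adj_of_lt (h : v < u) : (lowerGraph B).Adj u v ↔ B u v ≠ 0 := by
  simp [lowerGraph, h, h.ne', h.not_gt]

theorem FillPath.structNonzero (h : FillPath (lowerGraph B) t u v) (htv : t ≤ v) (hvu : v ≤ u) :
    StructNonzero B u v := by
  induction t generalizing u v with
  | zero =>
    cases h with
    | edge hadj => exact .input _ _ hvu ((lowerGraph_adj_of_lt (hvu.lt_of_ne' hadj.ne)).1 hadj)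
    | snoc _ hw _ => exact absurd hw (Nat.not_lt_zero _)
  | succ t ih =>
    rcases h.split_at with h | ⟨w, rfl, huw, hwv⟩
    · exact ih h (Nat.le_of_succ_le htv) hvu
    · have hwv_lt : w < v := htv
      exact .fill _ _ w hwv_lt hvu (ih huw le_rfl (hwv_lt.le.trans hvu))
        (ih hwv.symm le_rfl hwv_lt.le)

end FillPaths

/-! ### Dense blocks of the factor -/

/-- All positions `(i, j)`, `j ≤ i`, with indices in `S` satisfy `Nz`: the rows and columns in `S`
form a dense lower triangular block. -/
def IsDenseBlock {N : ℕ} (Nz : Fin N → Fin N → Prop) (S : Finset (Fin N)) : Prop :=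
  ∀ i ∈ S, ∀ j ∈ S, j ≤ i → Nz i j

section DenseBlocks

open SimpleGraph

variable {N : ℕ} {B : Matrix (Fin N) (Fin N) ℝ} {α β : Type*} [Fintype β]
  {G₁ : SimpleGraph α} {G₂ : SimpleGraph β}

/- When the row `r` has been eliminated, it is a connected set that every column other than `j₀`
leaves; the nodes where these columns leave the eliminated set are pairwise joined by fill paths. -/
theorem exists_isDenseBlock_of_row (h₁ : G₁.Preconnected) (h₂ : G₂.Preconnected)
    (f : Copy (G₁ □ G₂) (lowerGraph B)) {r : α} {j₀ : β} (hrow : ∀ j, f (r, j) ≤ f (r, j₀))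
    (hcol : ∀ j, j ≠ j₀ → ∃ i, f (r, j₀) < f (i, j)) :
    ∃ S : Finset (Fin N), Fintype.card β ≤ S.card + 1 ∧ IsDenseBlock (StructNonzero B) S := by
  classical
  let t : ℕ := f (r, j₀) + 1
  have hlow (j : β) : (f (r, j) : ℕ) < t := Nat.lt_succ_of_le (hrow j)
  have hexit (j : {j // j ≠ j₀}) :
      ∃ i, t ≤ f (i, ↑j) ∧ FillPath (lowerGraph B) t (f (r, ↑j)) (f (i, ↑j)) := by
    obtain ⟨i, hi⟩ := hcol j j.2
    obtain ⟨p⟩ := h₁ r i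
    exact FillPath.exists_of_walk (f.toHom.comp (G₁.boxProdLeft G₂ ↑j).toHom) (hlow j) hi p
  choose exit hexit_ge hexit_path using hexit
  let e : {j // j ≠ j₀} → Fin N := fun j => f (exit j, j)
  have he : Function.Injective e := fun j j' h =>
    Subtype.ext (congrArg Prod.snd (f.injective h))
  refine ⟨Finset.univ.image e, ?_, ?_⟩
  · rw [Finset.card_image_of_injective _ he, Finset.card_univ, Fintype.card_subtype_compl,
      Fintype.card_subtype_eq]
    omega
  · intro _ hi _ hj hji
    obtain ⟨a, -, rfl⟩ := Finset.mem_image.1 hi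
    obtain ⟨b, -, rfl⟩ := Finset.mem_image.1 hj
    obtain ⟨p⟩ := h₂ a b
    have hrow_path : FillPath (lowerGraph B) t (e a) (f (r, ↑b)) :=
      (hexit_path a).symm.trans_walk (f.toHom.comp (G₁.boxProdRight G₂ r).toHom) hlow p
    exact (hrow_path.trans (hlow b) (hexit_path b)).structNonzero (hexit_ge b) hji

/- The row or column to use is the one whose last node comes first. -/
theorem exists_isDenseBlock [Fintype α] [Nonempty α] [Nonempty β] (h₁ : G₁.Preconnected)
    (h₂ : G₂.Preconnected) (f : Copy (G₁ □ G₂) (lowerGraph B)) :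
    ∃ S : Finset (Fin N), min (Fintype.card α) (Fintype.card β) ≤ S.card + 1 ∧
      IsDenseBlock (StructNonzero B) S := by
  choose rowLast hrowLast using fun r => Finite.exists_max fun j => f (r, j)
  choose colLast hcolLast using fun c => Finite.exists_max fun i => f (i, c)
  obtain ⟨r, hr⟩ := Finite.exists_min fun r => f (r, rowLast r)
  obtain ⟨c, hc⟩ := Finite.exists_min fun c => f (colLast c, c)
  rcases le_total (f (r, rowLast r)) (f (colLast c, c)) with hrc | hcr
  · obtain ⟨S, hcard, hS⟩ := exists_isDenseBlock_of_row h₁ h₂ f (hrowLast r) fun j hj =>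
      ⟨colLast j, (hrc.trans (hc j)).lt_of_ne fun heq =>
        hj (congrArg Prod.snd (f.injective heq)).symm⟩
    exact ⟨S, (min_le_right _ _).trans hcard, hS⟩
  · obtain ⟨S, hcard, hS⟩ := exists_isDenseBlock_of_row h₂ h₁
      (f.comp (boxProdComm G₂ G₁).toCopy) (hcolLast c) fun i hi =>
      ⟨rowLast i, (hcr.trans (hr i)).lt_of_ne fun heq =>
        hi (congrArg Prod.fst (f.injective heq)).symm⟩
    exact ⟨S, (min_le_left _ _).trans hcard, hS⟩

end DenseBlocks

/-! ### Absence of cancellation -/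

namespace IsCholeskyFactor

variable {N : ℕ} {B L : Matrix (Fin N) (Fin N) ℝ} {i j : Fin N}

theorem apply (h : IsCholeskyFactor B L) (i j : Fin N) :
    B i j = L i j * L j j + ∑ k ∈ Finset.Iio j, L i k * L j k := by
  have hprod : B i j = ∑ k, L i k * L j k := by
    rw [← h.2.2, Matrix.mul_apply]
    rfl
  rw [hprod, ← Finset.sum_insert (f := fun k => L i k * L j k) Finset.notMem_Iio_self,
    Finset.Iio_insert]
  refine (Finset.sum_subset (Finset.subset_univ _) fun k _ hk => ?_).symm
  rw [h.1 j k (by simpa using hk), mul_zero]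

theorem apply_self_pos (h : IsCholeskyFactor B L) (i : Fin N) : 0 < B i i := by
  rw [h.apply]
  exact add_pos_of_pos_of_nonneg (mul_pos (h.2.1 i) (h.2.1 i))
    (Finset.sum_nonneg fun k _ => mul_self_nonneg _)

theorem neg_iff (h : IsCholeskyFactor B L) :
    L i j < 0 ↔ B i j < ∑ k ∈ Finset.Iio j, L i k * L j k := by
  rw [h.apply i j, add_lt_iff_neg_right]
  refine ⟨fun hL => mul_neg_of_neg_of_pos hL (h.2.1 j), fun hL => ?_⟩
  exact neg_of_mul_neg_left hL (h.2.1 j).le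

theorem nonpos_iff (h : IsCholeskyFactor B L) :
    L i j ≤ 0 ↔ B i j ≤ ∑ k ∈ Finset.Iio j, L i k * L j k := by
  rw [h.apply i j, add_le_iff_nonpos_left]
  refine ⟨fun hL => mul_nonpos_of_nonpos_of_nonneg hL (h.2.1 j).le, fun hL => ?_⟩
  exact nonpos_of_mul_nonpos_left hL (h.2.1 j)

theorem nonpos_of_lt (h : IsCholeskyFactor B L) (hB : ∀ i j, j < i → B i j ≤ 0) (hji : j < i) :
    L i j ≤ 0 := by
  induction j using WellFoundedLT.induction generalizing i with
  | ind j ih =>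
    refine h.nonpos_iff.2 ((hB i j hji).trans (Finset.sum_nonneg fun k hk => ?_))
    have hkj := Finset.mem_Iio.1 hk
    exact mul_nonneg_of_nonpos_of_nonpos (ih k hkj (hkj.trans hji)) (ih k hkj hkj)

theorem neg_of_structNonzero (h : IsCholeskyFactor B L) (hB : ∀ i j, j < i → B i j ≤ 0)
    (hij : StructNonzero B i j) (hji : j < i) : L i j < 0 := by
  have hterm {i j : Fin N} (hji : j < i) (k) (hk : k ∈ Finset.Iio j) : 0 ≤ L i k * L j k :=
    have hkj := Finset.mem_Iio.1 hk
    mul_nonneg_of_nonpos_of_nonpos (h.nonpos_of_lt hB (hkj.trans hji)) (h.nonpos_of_lt hB hkj)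
  induction hij with
  | input i j _ hBij =>
    exact h.neg_iff.2 (((hB i j hji).lt_of_ne hBij).trans_le (Finset.sum_nonneg (hterm hji)))
  | fill i j k hkj _ _ _ ihik ihjk =>
    refine h.neg_iff.2 ((hB i j hji).trans_lt (Finset.sum_pos' (hterm hji) ⟨k, ?_⟩))
    exact ⟨Finset.mem_Iio.2 hkj, mul_pos_of_neg_of_neg (ihik (hkj.trans hji)) (ihjk hkj)⟩

theorem ne_zero_of_structNonzero (h : IsCholeskyFactor B L) (hB : ∀ i j, j < i → B i j ≤ 0)
    (hij : StructNonzero B i j) : L i j ≠ 0 := by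
  have hji : j ≤ i := by cases hij <;> assumption
  rcases hji.eq_or_lt with rfl | hlt
  · exact (h.2.1 _).ne'
  · exact (h.neg_of_structNonzero hB hij hlt).ne

end IsCholeskyFactor

/-! ### Counting triples -/

theorem loomis_whitney_card_sq_le {α β γ : Type*} {D : Finset (α × β × γ)} {P : Finset (α × β)}
    {Q : Finset (α × γ)} {R : Finset (β × γ)}
    (hD : ∀ a b c, (a, b, c) ∈ D → (a, b) ∈ P ∧ (a, c) ∈ Q ∧ (b, c) ∈ R) :
    D.card ^ 2 ≤ P.card * (Q.card * R.card) := by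
  classical
  let fiber (p : α × β) : Finset (α × β × γ) := {d ∈ D | (d.1, d.2.1) = p}
  have hfiber : D.card = ∑ p ∈ P, (fiber p).card :=
    Finset.card_eq_sum_card_fiberwise fun d hd => (hD d.1 d.2.1 d.2.2 hd).1
  -- A pair of triples `(a, b, c)`, `(a, b, c')` is determined by `(a, c)` and `(b, c')`.
  have hpairs : ∑ p ∈ P, (fiber p).card ^ 2 ≤ Q.card * R.card := by
    simp only [sq, ← Finset.card_product, ← Finset.card_sigma]
    refine Finset.card_le_card_of_injOn
      (fun x => ((x.2.1.1, x.2.1.2.2), (x.2.2.2.1, x.2.2.2.2))) ?_ ?_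
    · rintro ⟨p, ⟨a, b, c⟩, ⟨a', b', c'⟩⟩ hx
      grind
    · rintro ⟨p, ⟨a, b, c⟩, ⟨a', b', c'⟩⟩ hx ⟨q, ⟨u, v, w⟩, ⟨u', v', w'⟩⟩ hy hxy
      grind
  calc D.card ^ 2 = (∑ p ∈ P, (fiber p).card) ^ 2 := by rw [hfiber]
    _ ≤ P.card * ∑ p ∈ P, (fiber p).card ^ 2 := sq_sum_le_card_mul_sum_sq
    _ ≤ P.card * (Q.card * R.card) := Nat.mul_le_mul_left _ hpairs

theorem choose_three_le_card_decreasing {α : Type*} [LinearOrder α] (S : Finset α) :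
    S.card.choose 3 ≤ {p ∈ S ×ˢ S ×ˢ S | p.2.2 < p.2.1 ∧ p.2.1 < p.1}.card := by
  rw [← Finset.card_powersetCard]
  refine Finset.card_le_card_of_surjOn (fun p => {p.1, p.2.1, p.2.2}) fun T hT => ?_
  obtain ⟨hTS, hT3⟩ := Finset.mem_powersetCard.1 hT
  let e := T.orderEmbOfFin hT3
  have heS (x : Fin 3) : e x ∈ S := hTS (T.orderEmbOfFin_mem hT3 x)
  refine ⟨(e 2, e 1, e 0), ?_, ?_⟩
  · simp [heS]
  · have hT : T = Finset.univ.image e := (T.image_orderEmbOfFin_univ hT3).symm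
    have huniv : (Finset.univ : Finset (Fin 3)) = {2, 1, 0} := by decide
    rw [hT, huniv, Finset.image_insert, Finset.image_insert, Finset.image_singleton]

/-! ### Invariants of an execution -/

section Machine

variable {N M : ℕ} {B : Matrix (Fin N) (Fin N) ℝ} {Nz : Fin N → Fin N → Prop} {s t : State N}
  {i j k : Fin N} {d W : ℕ}

/-- The position of the factor that a word contributes to. The projections of a set of products are
counted by positions, so that all partial sums for one entry, and the entry itself, count once. -/
def Word.pos : Word N → Fin N × Fin N
  | .part i j _ => (i, j)
  | .entry i j => (i, j)

/-- The word `w` is in fast or slow memory. -/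
def State.Avail (s : State N) (w : Word N) : Prop :=
  w ∈ s.fast ∨ w ∈ s.slow

/-- The invariant of the machine: fast memory is not overfull, and only computed entries of the
factor are in memory. -/
structure State.Consistent (M : ℕ) (s : State N) : Prop where
  card_fast_le : s.fast.card ≤ M
  computed_of_avail : ∀ {i j}, s.Avail (.entry i j) → (i, j) ∈ s.computed

/-- Every computed entry of the factor that is not known to be zero is still in memory. -/
def State.Retains (Nz : Fin N → Fin N → Prop) (s : State N) : Prop :=
  ∀ {i j}, j ≤ i → Nz i j → (i, j) ∈ s.computed → s.Avail (.entry i j)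

/-- The product `L i k * L j k` is contained in an available partial sum of `L i j`, or `L i j` has
been computed. -/
def State.Holds (s : State N) (i j k : Fin N) : Prop :=
  (∃ K, some k ∈ K ∧ s.Avail (.part i j K)) ∨ (i, j) ∈ s.computed

/-- The input `B i j` is contained in a partial sum of `L i j` in fast memory, or `L i j` has been
computed. -/
def State.InputRead (s : State N) (i j : Fin N) : Prop :=
  (∃ K, none ∈ K ∧ Word.part i j K ∈ s.fast) ∨ (i, j) ∈ s.computed

/-- `L i j` is computed in the state `t`; if it was computed before the state `s` already, it is a
word of the fast memory of `s` or one of the words `X`. Here `s` and `t` are the ends of a segment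
of an execution, and `X` are the words moved in between. -/
def Accessed (s t : State N) (X : Finset (Word N)) (i j : Fin N) : Prop :=
  (i, j) ∈ t.computed ∧ ((i, j) ∈ s.computed → .entry i j ∈ s.fast ∪ X)

/-- The product `L i k * L j k` may not be left out of the sum for `L i j`, and `L i j` has to be in
memory in the end. -/
structure IsRequired (Nz : Fin N → Fin N → Prop) (i j k : Fin N) : Prop where
  lt : k < j
  le : j ≤ i
  nz : Nz i j
  nz_left : Nz i k
  nz_right : Nz j k

theorem State.consistent_initial : (State.initial N).Consistent M where
  card_fast_le := by simp [State.initial]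
  computed_of_avail := by simp [State.initial, State.Avail]

theorem State.not_holds_initial : ¬ (State.initial N).Holds i j k := by
  simp [State.Holds, State.Avail, State.initial]

theorem State.not_inputRead_initial : ¬ (State.initial N).InputRead i j := by
  simp [State.InputRead, State.initial]

theorem Accessed.mono {s t u : State N} {X Y : Finset (Word N)} (h : Accessed s t X i j)
    (hXY : X ⊆ Y) (htu : t.computed ⊆ u.computed) : Accessed s u Y i j :=
  ⟨htu h.1, fun hs => Finset.union_subset_union_right hXY (h.2 hs)⟩

namespace Step

theorem computed_subset (h : Step M B Nz s d t) : s.computed ⊆ t.computed := by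
  cases h <;> grind

theorem cost_le_one (h : Step M B Nz s d t) : d ≤ 1 := by
  cases h <;> simp

theorem consistent (h : Step M B Nz s d t) (hs : s.Consistent M) : t.Consistent M := by
  obtain ⟨hcard, hcomp⟩ := hs
  refine ⟨?_, fun {i j} => ?_⟩
  · cases h <;> first | assumption | exact (Finset.card_le_card ‹_›).trans hcard
  · unfold State.Avail at hcomp ⊢
    cases h <;> grind

theorem avail_of_computed (h : Step M B Nz s d t) (hs : (i, j) ∈ s.computed)
    (ht : t.Avail (.entry i j)) : s.Avail (.entry i j) := by
  unfold State.Avail at ht ⊢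
  cases h <;> grind

/- Sums are moved, added up and finished without gaining products; only a multiplication creates a
new one, and it has both factors in fast memory. -/
theorem mem_fast_of_holds (h : Step M B Nz s d t) (hkj : k < j) (hik : Nz i k) (hjk : Nz j k)
    (hs : ¬ s.Holds i j k) (ht : t.Holds i j k) :
    .entry i k ∈ s.fast ∧ .entry j k ∈ s.fast := by
  unfold State.Holds State.Avail at hs ht
  cases h <;> grind

theorem exists_moved (h : Step M B Nz s d t) :
    ∃ X : Finset (Word N), X.card ≤ d ∧ t.slow ⊆ s.slow ∪ X ∧
      ∀ i j, (i, j) ∈ s.computed → .entry i j ∈ t.fast → .entry i j ∈ s.fast ∪ X := by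
  cases h with
  | load w | store w => exact ⟨{w}, by grind⟩
  | _ => exact ⟨∅, by grind⟩

theorem exists_inputRead (h : Step M B Nz s d t) :
    ∃ X : Finset (Fin N × Fin N), X.card ≤ d ∧
      ∀ i j, B i j ≠ 0 → t.InputRead i j → s.InputRead i j ∨ (i, j) ∈ X := by
  unfold State.InputRead
  cases h with
  | load w => exact ⟨{w.pos}, by grind [Word.pos]⟩
  | _ => exact ⟨∅, by grind⟩

end Step

namespace Run

theorem computed_subset (h : Run M B Nz s W t) : s.computed ⊆ t.computed := by
  induction h with
  | nil => exact subset_rfl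
  | snoc _ _ _ _ _ hstep ih => exact ih.trans hstep.computed_subset

theorem consistent (h : Run M B Nz s W t) (hs : s.Consistent M) : t.Consistent M := by
  induction h with
  | nil => exact hs
  | snoc _ _ _ _ _ hstep ih => exact hstep.consistent ih

theorem retains (h : Run M B Nz s W t) (ht : t.Retains Nz) : s.Retains Nz := by
  induction h with
  | nil => exact ht
  | snoc _ _ _ _ _ hstep ih =>
    exact ih fun hji hij hc =>
      hstep.avail_of_computed hc (ht hji hij (hstep.computed_subset hc))

theorem exists_split (h : Run M B Nz s W t) {W' : ℕ} (hW : W' ≤ W) :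
    ∃ u, Run M B Nz s W' u ∧ Run M B Nz u (W - W') t := by
  induction h with
  | nil =>
    obtain rfl := Nat.le_zero.1 hW
    exact ⟨s, .nil s, .nil s⟩
  | snoc t v W d hrun hstep ih =>
    rcases le_or_gt W' W with hle | hlt
    · obtain ⟨u, hsu, hut⟩ := ih hle
      exact ⟨u, hsu, Nat.sub_add_comm hle ▸ hut.snoc _ _ _ _ _ hstep⟩
    · have hd := hstep.cost_le_one
      obtain rfl : W' = W + d := by omega
      exact ⟨v, hrun.snoc _ _ _ _ _ hstep, by simpa using Run.nil v⟩

theorem exists_inputRead (h : Run M B Nz s W t) :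
    ∃ X : Finset (Fin N × Fin N), X.card ≤ W ∧
      ∀ i j, B i j ≠ 0 → t.InputRead i j → s.InputRead i j ∨ (i, j) ∈ X := by
  induction h with
  | nil => exact ⟨∅, by simp⟩
  | snoc t u W d _ hstep ih =>
    obtain ⟨X, hXcard, hX⟩ := ih
    obtain ⟨Y, hYcard, hY⟩ := hstep.exists_inputRead
    exact ⟨X ∪ Y, (Finset.card_union_le X Y).trans (add_le_add hXcard hYcard), by grind⟩

theorem exists_moved (h : Run M B Nz s W t) (hs : s.Consistent M) :
    ∃ X : Finset (Word N), X.card ≤ W ∧ t.slow ⊆ s.slow ∪ X ∧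
      (∀ i j, .entry i j ∈ t.fast → Accessed s t X i j) ∧
      ∀ i j k, k < j → Nz i k → Nz j k → ¬ s.Holds i j k → t.Holds i j k →
        Accessed s t X i k ∧ Accessed s t X j k := by
  induction h with
  | nil =>
    refine ⟨∅, by simp, by simp, fun i j hij => ⟨hs.computed_of_avail (.inl hij), ?_⟩, ?_⟩
    · simpa using fun _ => hij
    · exact fun i j k _ _ _ hnot hholds => absurd hholds hnot
  | snoc t u W d hrun hstep ih =>
    obtain ⟨X, hXcard, hXslow, hXfast, hXholds⟩ := ih
    obtain ⟨Y, hYcard, hYslow, hYfast⟩ := hstep.exists_moved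
    have ht := hrun.consistent hs
    have mono {i j} (h : Accessed s t X i j) : Accessed s u (X ∪ Y) i j :=
      h.mono Finset.subset_union_left hstep.computed_subset
    refine ⟨X ∪ Y, (Finset.card_union_le X Y).trans (add_le_add hXcard hYcard), ?_, ?_, ?_⟩
    · rw [Finset.coe_union, ← Set.union_assoc]
      exact hYslow.trans (Set.union_subset_union_left _ hXslow)
    · intro i j hij
      refine ⟨(hstep.consistent ht).computed_of_avail (.inl hij), fun hc => ?_⟩
      rcases Finset.mem_union.1 (hYfast i j (hrun.computed_subset hc) hij) with hmem | hmem
      · exact (mono (hXfast i j hmem)).2 hc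
      · grind
    · intro i j k hkj hik hjk hnot hholds
      by_cases hmid : t.Holds i j k
      · exact (hXholds i j k hkj hik hjk hnot hmid).imp mono mono
      · exact (hstep.mem_fast_of_holds hkj hik hjk hmid hholds).imp
          (fun h => mono (hXfast i k h)) (fun h => mono (hXfast j k h))

/- The set consists of the positions of all words that are in fast memory at one of the ends of the
segment, or are moved within it. -/
theorem exists_positions (h : Run M B Nz s W t) (hs : s.Consistent M) (ht : t.Retains Nz) :
    ∃ P : Finset (Fin N × Fin N), P.card ≤ 2 * M + W ∧
      ∀ i j k, IsRequired Nz i j k → ¬ s.Holds i j k → t.Holds i j k →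
        (i, j) ∈ P ∧ (i, k) ∈ P ∧ (j, k) ∈ P := by
  obtain ⟨X, hXcard, hXslow, -, hXholds⟩ := h.exists_moved hs
  let words := s.fast ∪ X ∪ t.fast
  have mem_words {w} (hw : t.Avail w) (hslow : w ∉ s.slow) : w ∈ words := by
    unfold State.Avail at hw
    grind
  have mem_image {w} (hw : w ∈ words) : w.pos ∈ words.image Word.pos :=
    Finset.mem_image_of_mem _ hw
  have mem_of_accessed {i j} (hji : j ≤ i) (hij : Nz i j) (ha : Accessed s t X i j) :
      (i, j) ∈ words.image Word.pos := by
    by_cases hc : (i, j) ∈ s.computed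
    · exact mem_image (Finset.mem_union_left _ (ha.2 hc))
    · exact mem_image (mem_words (ht hji hij ha.1) fun hslow =>
        hc (hs.computed_of_avail (.inr hslow)))
  refine ⟨words.image Word.pos, ?_, fun i j k hreq hnot hholds => ?_⟩
  · calc (words.image Word.pos).card ≤ words.card := Finset.card_image_le
      _ ≤ s.fast.card + X.card + t.fast.card :=
        (Finset.card_union_le _ _).trans (Nat.add_le_add_right (Finset.card_union_le _ _) _)
      _ ≤ M + W + M :=
        add_le_add (add_le_add hs.card_fast_le hXcard) (h.consistent hs).card_fast_le
      _ = 2 * M + W := by ring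
  · have hfactors := hXholds i j k hreq.lt hreq.nz_left hreq.nz_right hnot hholds
    refine ⟨?_, mem_of_accessed (hreq.lt.le.trans hreq.le) hreq.nz_left hfactors.1,
      mem_of_accessed hreq.lt.le hreq.nz_right hfactors.2⟩
    rcases hholds with ⟨K, hK, havail⟩ | hc
    · exact mem_image (mem_words havail fun hslow => hnot (.inl ⟨K, hK, .inr hslow⟩))
    · exact mem_of_accessed hreq.le hreq.nz ⟨hc, fun hc => absurd (.inr hc) hnot⟩

theorem card_sq_le (h : Run M B Nz s W t) (hs : s.Consistent M) (ht : t.Retains Nz)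
    {D : Finset (Fin N × Fin N × Fin N)} (hD : ∀ i j k, (i, j, k) ∈ D →
      IsRequired Nz i j k ∧ ¬ s.Holds i j k ∧ t.Holds i j k) :
    D.card ^ 2 ≤ (2 * M + W) ^ 3 := by
  obtain ⟨P, hPcard, hP⟩ := h.exists_positions hs ht
  have hproj (i j k) (hijk : (i, j, k) ∈ D) : (i, j) ∈ P ∧ (i, k) ∈ P ∧ (j, k) ∈ P :=
    have ⟨hreq, hnot, hholds⟩ := hD i j k hijk
    hP i j k hreq hnot hholds
  calc D.card ^ 2 ≤ P.card * (P.card * P.card) := loomis_whitney_card_sq_le hproj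
    _ = P.card ^ 3 := by ring
    _ ≤ (2 * M + W) ^ 3 := Nat.pow_le_pow_left hPcard 3

/- Cut the execution into segments that move `M` words, except for a shorter first one. -/
theorem card_le_mul_sqrt (h : Run M B Nz (.initial N) W t) (hM : 1 ≤ M) (ht : t.Retains Nz)
    {D : Finset (Fin N × Fin N × Fin N)}
    (hD : ∀ i j k, (i, j, k) ∈ D → IsRequired Nz i j k ∧ t.Holds i j k) :
    D.card ≤ (W / M + 1) * ((3 * M) ^ 3).sqrt := by
  classical
  induction W using Nat.strong_induction_on generalizing t D with
  | _ W ih =>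
    rcases Nat.lt_or_ge W M with hWM | hMW
    · have hsq : D.card ^ 2 ≤ (2 * M + W) ^ 3 := h.card_sq_le State.consistent_initial ht
        fun i j k hijk => ⟨(hD i j k hijk).1, State.not_holds_initial, (hD i j k hijk).2⟩
      rw [Nat.div_eq_of_lt hWM, zero_add, one_mul, Nat.le_sqrt']
      exact hsq.trans (Nat.pow_le_pow_left (by omega) 3)
    · obtain ⟨u, hinit, hlast⟩ := h.exists_split (Nat.sub_le W M)
      rw [Nat.sub_sub_self hMW] at hlast
      have hearly : (D.filter fun x => u.Holds x.1 x.2.1 x.2.2).card ≤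
          ((W - M) / M + 1) * ((3 * M) ^ 3).sqrt :=
        ih (W - M) (by omega) hinit (hlast.retains ht) fun i j k hijk => by grind
      have hlate : (D.filter fun x => ¬ u.Holds x.1 x.2.1 x.2.2).card ≤ ((3 * M) ^ 3).sqrt := by
        rw [Nat.le_sqrt', show 3 * M = 2 * M + M by ring]
        exact hlast.card_sq_le (hinit.consistent State.consistent_initial) ht
          fun i j k hijk => by grind
      have hdiv : (W - M) / M + 1 = W / M := (Nat.div_eq_sub_div hM hMW).symm
      rw [← Finset.card_filter_add_card_filter_not fun x => u.Holds x.1 x.2.1 x.2.2]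
      rw [hdiv] at hearly
      linarith

end Run

end Machine

/-! ### The communication bound -/

namespace FactorsWith

variable {N M W : ℕ} {B : Matrix (Fin N) (Fin N) ℝ} {Nz : Fin N → Fin N → Prop}

/- Every nonzero entry of `B` in this set has to be loaded. -/
theorem card_le (h : FactorsWith M B Nz W) {S : Finset (Fin N × Fin N)}
    (hS : ∀ i j, (i, j) ∈ S → j ≤ i ∧ B i j ≠ 0 ∧ Nz i j) : S.card ≤ W := by
  obtain ⟨t, hrun, hfinal⟩ := h
  obtain ⟨X, hXcard, hX⟩ := hrun.exists_inputRead
  refine (Finset.card_le_card ?_).trans hXcard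
  rintro ⟨i, j⟩ hij
  obtain ⟨hji, hB, hNz⟩ := hS i j hij
  have hcomp := (hrun.consistent State.consistent_initial).computed_of_avail (hfinal i j hji hNz)
  exact (hX i j hB (.inr hcomp)).resolve_left State.not_inputRead_initial

theorem dim_le (h : FactorsWith M B Nz W) (hB : ∀ i, B i i ≠ 0) (hNz : ∀ i, Nz i i) : N ≤ W := by
  have hdiag := h.card_le (S := Finset.univ.diag) fun i j hij => by
    obtain rfl : i = j := (Finset.mem_diag.1 hij).2
    exact ⟨le_rfl, hB i, hNz i⟩
  simpa using hdiag

theorem choose_three_le (h : FactorsWith M B Nz W) (hM : 1 ≤ M) {S : Finset (Fin N)}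
    (hS : IsDenseBlock Nz S) : S.card.choose 3 ≤ (W / M + 1) * ((3 * M) ^ 3).sqrt := by
  obtain ⟨t, hrun, hfinal⟩ := h
  refine (choose_three_le_card_decreasing S).trans
    (hrun.card_le_mul_sqrt hM (fun hji hij _ => hfinal _ _ hji hij) fun i j k hijk => ?_)
  simp only [Finset.mem_filter, Finset.mem_product] at hijk
  obtain ⟨⟨hi, hj, hk⟩, hkj, hji⟩ := hijk
  have hij := hS i hi j hj hji.le
  refine ⟨⟨hkj, hji.le, hij, hS i hi k hk (hkj.trans hji).le, hS j hj k hk hkj.le⟩, .inr ?_⟩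
  exact (hrun.consistent State.consistent_initial).computed_of_avail (hfinal i j hji.le hij)

end FactorsWith

theorem pow_three_le_mul_choose_three {n m : ℕ} (hn : 6 ≤ n) (hm : n ≤ m + 1) :
    n ^ 3 ≤ 48 * m.choose 3 := by
  have hpow : (n - 3) ^ 3 ≤ 6 * m.choose 3 :=
    calc (n - 3) ^ 3 ≤ (m + 1 - 3) ^ 3 := Nat.pow_le_pow_left (Nat.sub_le_sub_right hm 3) 3
      _ ≤ m.descFactorial 3 := Nat.pow_sub_le_descFactorial m 3
      _ = 6 * m.choose 3 := Nat.descFactorial_eq_factorial_mul_choose m 3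
  calc n ^ 3 ≤ (2 * (n - 3)) ^ 3 := Nat.pow_le_pow_left (by omega) 3
    _ = 8 * (n - 3) ^ 3 := by ring
    _ ≤ 8 * (6 * m.choose 3) := Nat.mul_le_mul_left 8 hpow
    _ = 48 * m.choose 3 := by ring

/- If `n < 6` or `n * n ≤ M`, the trivial bound `n * n ≤ W` is as strong as the claim; otherwise
`M ≤ W`, so that the incomplete first segment only costs a factor `2`. -/
theorem pow_six_le {n m M W : ℕ} (hM : 1 ≤ M) (hnW : n * n ≤ W) (hm : n ≤ m + 1)
    (hmW : m.choose 3 ≤ (W / M + 1) * ((3 * M) ^ 3).sqrt) : n ^ 6 ≤ M * (500 * W) ^ 2 := by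
  have hsq : n ^ 4 ≤ W ^ 2 := by
    calc n ^ 4 = (n * n) ^ 2 := by ring
      _ ≤ W ^ 2 := Nat.pow_le_pow_left hnW 2
  have hsmall {K : ℕ} (hK : n * n ≤ K * M) (hK36 : K ≤ 36) : n ^ 6 ≤ M * (500 * W) ^ 2 := by
    calc n ^ 6 = n * n * n ^ 4 := by ring
      _ ≤ K * M * W ^ 2 := Nat.mul_le_mul hK hsq
      _ ≤ 250000 * M * W ^ 2 := by gcongr; omega
      _ = M * (500 * W) ^ 2 := by ring
  rcases Nat.lt_or_ge n 6 with hn | hn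
  · exact hsmall (K := 36) (by nlinarith) le_rfl
  rcases Nat.le_or_ge (n * n) M with hnM | hMn
  · exact hsmall (K := 1) (by omega) (by norm_num)
  have hMW : M * (W / M + 1) ≤ 2 * W := by
    have hdiv := Nat.mul_div_le W M
    linarith
  have hchoose : m.choose 3 ^ 2 ≤ (W / M + 1) ^ 2 * (3 * M) ^ 3 :=
    calc m.choose 3 ^ 2 ≤ ((W / M + 1) * ((3 * M) ^ 3).sqrt) ^ 2 := Nat.pow_le_pow_left hmW 2
      _ = (W / M + 1) ^ 2 * ((3 * M) ^ 3).sqrt ^ 2 := mul_pow _ _ _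
      _ ≤ (W / M + 1) ^ 2 * (3 * M) ^ 3 := Nat.mul_le_mul_left _ (Nat.sqrt_le' _)
  calc n ^ 6 = (n ^ 3) ^ 2 := by ring
    _ ≤ (48 * m.choose 3) ^ 2 := Nat.pow_le_pow_left (pow_three_le_mul_choose_three hn hm) 2
    _ = 48 ^ 2 * m.choose 3 ^ 2 := by ring
    _ ≤ 48 ^ 2 * ((W / M + 1) ^ 2 * (3 * M) ^ 3) := Nat.mul_le_mul_left _ hchoose
    _ = 48 ^ 2 * 27 * M * (M * (W / M + 1)) ^ 2 := by ring
    _ ≤ 48 ^ 2 * 27 * M * (2 * W) ^ 2 := by gcongr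
    _ ≤ M * (500 * W) ^ 2 := by nlinarith [Nat.zero_le (M * W ^ 2)]

theorem div_sqrt_le_of_pow_six_le {n M W K : ℕ} (h : n ^ 6 ≤ M * (K * W) ^ 2) :
    (n : ℝ) ^ 3 / √M ≤ K * W := by
  refine div_le_of_le_mul₀ (Real.sqrt_nonneg _) (by positivity) ?_
  refine (sq_le_sq₀ (by positivity) (by positivity)).1 ?_
  calc ((n : ℝ) ^ 3) ^ 2 = (n ^ 6 : ℕ) := by push_cast; ring
    _ ≤ (M * (K * W) ^ 2 : ℕ) := Nat.cast_le.2 h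
    _ = (K * W * √M) ^ 2 := by
      rw [mul_pow _ √(M : ℝ), Real.sq_sqrt M.cast_nonneg]
      push_cast
      ring

/-! ### Five-point stencils -/

variable {n : ℕ} {A : Matrix (Fin n × Fin n) (Fin n × Fin n) ℝ}

theorem grid_isContained_lowerGraph_reorder (hA : ∀ p q, (grid n).Adj p q → A p q ≠ 0)
    (σ : Fin n × Fin n ≃ Fin (n * n)) : (grid n).IsContained (lowerGraph (reorder A σ)) := by
  have hadj {p q} (hpq : (grid n).Adj p q) : (lowerGraph (reorder A σ)).Adj (σ p) (σ q) := by
    rcases (σ.injective.ne hpq.ne).lt_or_gt with hlt | hgt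
    · exact ((lowerGraph_adj_of_lt hlt).2 (by simpa [reorder] using hA q p hpq.symm)).symm
    · exact (lowerGraph_adj_of_lt hgt).2 (by simpa [reorder] using hA p q hpq)
  exact ⟨⟨⟨σ, hadj⟩, σ.injective⟩⟩

theorem IsFivePointMatrix.reorder_nonpos_of_ne (hA : IsFivePointMatrix A)
    (σ : Fin n × Fin n ≃ Fin (n * n)) {i j : Fin (n * n)} (hij : i ≠ j) : reorder A σ i j ≤ 0 := by
  obtain ⟨hneg, hzero⟩ := hA _ _ (σ.symm.injective.ne hij)
  by_cases hadj : (grid n).Adj (σ.symm i) (σ.symm j)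
  · exact (hneg hadj).le
  · exact (hzero hadj).le

end SparseCholesky

theorem mainTheorem8_general :
    ∃ c : ℝ, 0 < c ∧
      ∀ (n M N : ℕ), 1 ≤ M →
      ∀ (B : Matrix (Fin N) (Fin N) ℝ) (Nz : Fin N → Fin N → Prop),
        (SparseCholesky.grid n).IsContained (SparseCholesky.lowerGraph B) →
        (∀ i, B i i ≠ 0) →
        (∀ i j, SparseCholesky.StructNonzero B i j → Nz i j) →
        ∀ W : ℕ, SparseCholesky.FactorsWith M B Nz W → c * ((n : ℝ) ^ 3 / √(M : ℝ)) ≤ (W : ℝ) := by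
  refine ⟨1 / 500, by norm_num, fun n M N hM B Nz ⟨f⟩ hdiag hNz W hW => ?_⟩
  have hNW : N ≤ W := hW.dim_le hdiag fun i => hNz i i (.input i i le_rfl (hdiag i))
  have hnN : n * n ≤ N := by simpa using Fintype.card_le_of_injective f f.injective
  obtain ⟨S, hcard, hS⟩ : ∃ S : Finset (Fin N), n ≤ S.card + 1 ∧
      SparseCholesky.IsDenseBlock (SparseCholesky.StructNonzero B) S := by
    rcases Nat.eq_zero_or_pos n with rfl | hn
    · exact ⟨∅, by simp, by simp [SparseCholesky.IsDenseBlock]⟩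
    · have : Nonempty (Fin n) := ⟨⟨0, hn⟩⟩
      have hconn := SimpleGraph.pathGraph_preconnected n
      simpa using SparseCholesky.exists_isDenseBlock hconn hconn f
  have hchoose := hW.choose_three_le hM fun i hi j hj hji => hNz i j (hS i hi j hj hji)
  have hsix := SparseCholesky.pow_six_le hM (hnN.trans hNW) hcard hchoose
  have hbound := SparseCholesky.div_sqrt_le_of_pow_six_le hsix
  push_cast at hbound
  linarith

theorem mainTheorem8 :
    ∃ c : ℝ, 0 < c ∧
      ∀ (n M : ℕ), 1 ≤ n → 1 ≤ M →
      ∀ (A : Matrix (Fin n × Fin n) (Fin n × Fin n) ℝ) (σ : Fin n × Fin n ≃ Fin (n * n)),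
        -- a five-point matrix, where only multiplications by exact zeros of its factor are skipped
        (SparseCholesky.IsFivePointMatrix A →
          ∀ L : Matrix (Fin (n * n)) (Fin (n * n)) ℝ,
            SparseCholesky.IsCholeskyFactor (SparseCholesky.reorder A σ) L →
            ∀ W : ℕ,
              SparseCholesky.FactorsWith M (SparseCholesky.reorder A σ)
                (fun i j => L i j ≠ 0) W →
              c * ((n : ℝ) ^ 3 / √(M : ℝ)) ≤ (W : ℝ)) ∧
        -- any matrix that contains the structure, where only structural zeros are exploited
        (A.PosDef → (∀ p q, (SparseCholesky.grid n).Adj p q → A p q ≠ 0) →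
          ∀ W : ℕ,
            SparseCholesky.FactorsWith M (SparseCholesky.reorder A σ)
              (SparseCholesky.StructNonzero (SparseCholesky.reorder A σ)) W →
            c * ((n : ℝ) ^ 3 / √(M : ℝ)) ≤ (W : ℝ)) := by
  obtain ⟨c, hc, hbound⟩ := mainTheorem8_general
  refine ⟨c, hc, fun n M _ hM A σ => ⟨fun hA L hL W hW => ?_, fun hpos hA W hW => ?_⟩⟩
  · exact hbound n M _ hM _ _
      (SparseCholesky.grid_isContained_lowerGraph_reorder (fun p q h => ((hA p q h.ne).1 h).ne) σ)
      (fun i => (hL.apply_self_pos i).ne')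
      (fun i j => hL.ne_zero_of_structNonzero fun i j hji => hA.reorder_nonpos_of_ne σ hji.ne')
      W hW
  · exact hbound n M _ hM _ _ (SparseCholesky.grid_isContained_lowerGraph_reorder hA σ)
      (fun i => hpos.diag_pos.ne') (fun _ _ h => h) W hW
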